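/- Let $X$ be a finite alphabet in which every letter $a$ has an arity $\mathrm{ar}(a)\ge 0$, and let exactly one letter $x\in X$ have arity $0$. An $X$-tree is a planar rooted tree with vertices labelled by letters of $X$ such that a vertex labelled $a$ has exactly $\mathrm{ar}(a)$ children; the leaves, which are all labelled $x$, are called free ends. A tree $T$ contains a tree $p$ if, for some vertex $v$ of $T$, the subtree of $T$ consisting of $v$ and all its descendants can be obtained from $p$ by replacing some (possibly none) of the free ends of $p$ with trees. Let $Y$ be a finite set of $X$-trees, and let $L(X|Y)\subseteq X^*$ be the language of the words which encode, in Polish (prefix) notation, the $X$-trees containing no element of $Y$. Assign to each letter $a\in X$ a nonzero weight $w(a)\in\mathbb{Z}_{\ge 0}^s$, extend $w$ to words by $w(uv)=w(u)+w(v)$, and let $$H(z)=\sum_{u\in L(X|Y)} z^{w(u)}\in\mathbb{Z}[[z_1,\dots,z_s]],\qquad z^{(n_1,\dots,n_s)}=z_1^{n_1}\cdots z_s^{n_s}.$$ Then $H(z)$ satisfies a nontrivial algebraic equation with coefficients in $\mathbb{Z}[z]$: there is a nonzero polynomial $P\in\mathbb{Z}[z_1,\dots,z_s][T]$ with $P(H)=0$.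 If, moreover, the language has sub-exponential growth, that is, $\#\{u\in L(X|Y): |u|=n\}=o(c^n)$ as $n\to\infty$ for every real $c>1$ (where $|u|$ is the length of $u$), then $H(z)$ is rational: $H=p/q$ for some $p,q\in\mathbb{Z}[z_1,\dots,z_s]$ with $q(0)\ne 0$. -/

import Mathlib

open Filter Asymptotics

/-- Planar rooted trees whose vertices are labelled by letters of `X`, a vertex labelled `a` having
exactly `ar a` (linearly ordered) children. -/
inductive LTree {X : Type*} (ar : X → ℕ) : Type _
  | node (a : X) (children : Fin (ar a) → LTree ar) : LTree ar

namespace LTree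

variable {X : Type*} {ar : X → ℕ}

/-- Polish notation: the label of the root, followed by the words of its branches from left to
right. -/
def word : LTree ar → List X
  | node a c => a :: (List.ofFn fun i => (c i).word).flatten

/-- `IsRootedSubtree x t v`: the tree `v` is obtained from `t` by grafting trees onto free ends
of `t`, where the free ends are the vertices labelled `x`. -/
inductive IsRootedSubtree (x : X) : LTree ar → LTree ar → Prop
  | freeEnd (c : Fin (ar x) → LTree ar) (v : LTree ar) : IsRootedSubtree x (node x c) v
  | node (a : X) (c d : Fin (ar a) → LTree ar) (h : ∀ i, IsRootedSubtree x (c i) (d i)) :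
      IsRootedSubtree x (node a c) (node a d)

/-- `Contains x p v`: the tree `v` contains the pattern `p` as a labelled subtree, rooted at some
vertex of `v`; the free ends `x` of `p` may be continued by arbitrary trees. -/
inductive Contains (x : X) (p : LTree ar) : LTree ar → Prop
  | root (v : LTree ar) (h : IsRootedSubtree x p v) : Contains x p v
  | child (a : X) (c : Fin (ar a) → LTree ar) (i : Fin (ar a)) (h : Contains x p (c i)) :
      Contains x p (node a c)

/-- The tree `v` avoids the set of patterns `Y`. -/
def Avoids (x : X) (Y : Set (LTree ar)) (v : LTree ar) : Prop :=
  ∀ p ∈ Y, ¬ Contains x p v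

/-- The language `L(X|Y)` of the Polish words of all trees that avoid the patterns in `Y`. -/
def avoidingLanguage (x : X) (Y : Set (LTree ar)) : Language X :=
  {u | ∃ t : LTree ar, Avoids x Y t ∧ t.word = u}

end LTree

/-- The additive extension to words of a weight function on letters. -/
noncomputable def wordWeight {X : Type*} {s : ℕ} (w : X → Fin s →₀ ℕ) (u : List X) : Fin s →₀ ℕ :=
  (u.map w).sum

/-- If every letter of a finite alphabet has nonzero weight, only finitely many words have a given
weight, so that the coefficients of the generating function below are true cardinalities. -/
theorem finite_wordWeight_eq {X : Type*} [Finite X] {s : ℕ} (w : X → Fin s →₀ ℕ)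
    (hw : ∀ a, w a ≠ 0) (n : Fin s →₀ ℕ) : {u : List X | wordWeight w u = n}.Finite := by
  refine (List.finite_length_le X n.degree).subset ?_
  rintro u rfl
  change u.length ≤ (wordWeight w u).degree
  induction u with
  | nil => simp
  | cons a u ih =>
    have h1 : 1 ≤ (w a).degree :=
      Nat.one_le_iff_ne_zero.mpr fun h => hw a ((Finsupp.degree_eq_zero_iff _).mp h)
    have h2 : wordWeight w (a :: u) = w a + wordWeight w u := by simp [wordWeight]
    rw [h2, map_add, List.length_cons]
    omega

/-- The weighted generating function `∑_{u ∈ L} z ^ w(u)` of a language `L`: the coefficient of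
`z ^ n` is the number of words of `L` of weight `n`. -/
noncomputable def weightedGenFun {X : Type*} {s : ℕ} (w : X → Fin s →₀ ℕ) (L : Language X) :
    MvPowerSeries (Fin s) ℤ :=
  fun n => (Set.ncard {u : List X | u ∈ L ∧ wordWeight w u = n} : ℤ)

/-- The growth function of a language: the number of its words of length `n`. -/
noncomputable def growthFun {X : Type*} (L : Language X) (n : ℕ) : ℕ :=
  Set.ncard {u : List X | u ∈ L ∧ u.length = n}

/-- The growth function is eventually dominated by every exponential `c ^ n` with `c > 1`. -/
def SubexponentialGrowth {X : Type*} (L : Language X) : Prop :=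
  ∀ c : ℝ, 1 < c → (fun n : ℕ => (growthFun L n : ℝ)) =o[atTop] (fun n : ℕ => c ^ n)

/-- The power series `F` is rational: it is the expansion at `0` of a quotient `p / q` of
polynomials with `q(0) ≠ 0`. -/
def IsRationalSeries {s : ℕ} (F : MvPowerSeries (Fin s) ℤ) : Prop :=
  ∃ p q : MvPolynomial (Fin s) ℤ, MvPolynomial.constantCoeff q ≠ 0 ∧
    (q : MvPowerSeries (Fin s) ℤ) * F = (p : MvPowerSeries (Fin s) ℤ)

/-!
The proof reads the language `L(X|Y)` off a finite deterministic tree automaton. The state of a tree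
(`LTree.patternState`) records which subtrees of forbidden trees it has at its root, and whether it
avoids `Y`; the state of a tree is determined by its root label and the states of its branches.
Cutting off the root (`LTree.decompose`) turns this into a polynomial system
`h q = ∑ z ^ w(a) ∏ h (r i)` for the generating functions `h q` of the trees of state `q`
(`LTree.stateGenFun_eq`), and the generating function of `L(X|Y)` is the sum of the `h q` over the
avoiding states `q`, since Polish notation is injective.

Algebraicity holds for any such system (`MvPowerSeries.isAlgebraic_of_polynomial_system`).
Let `J` be the matrix of partial derivatives of the right hand sides. It vanishes at `z = 0`, because
the weights are nonzero, so `det (1 - J)` is a nonzero power series. Differentiating the system over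
the field `K` of rational functions gives `(1 - J) dh = 0` in the Kähler differentials of
`K(h q : q)` over `K`, so that `dh = 0`; hence this finitely generated extension is unramified and,
in particular, algebraic.

For rationality, consider the strongly connected components of the relation "`r` occurs in trees
of state `q`". If some tree of avoiding state `q` had two branches in whose states `q` occurs again,
this would give an injective binary operation on the trees of state `q`, adding up lengths up to a
constant, and hence exponential growth (`LTree.not_subexponentialGrowth_of_branching`). Otherwise
every monomial of the system contains at most one unknown from the component of its left hand
side. By induction along the components, the unknowns of a component solve a linear system
`h = b + M h` with rational coefficients and `M` vanishing at `z = 0`, so they are rational by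
Cramer's rule (`LTree.isRationalSeries_stateGenFun`).
-/

open scoped Matrix

/-! ### Polish words of trees -/

theorem List.flatten_ofFn_append_inj {α β : Type*} (f : β → List α) {k : ℕ} (c d : Fin k → β)
    (hc : ∀ (i : Fin k) (t : β) (u v : List α), f (c i) ++ u = f t ++ v → c i = t ∧ u = v)
    (u v : List α)
    (h : (List.ofFn fun i => f (c i)).flatten ++ u = (List.ofFn fun i => f (d i)).flatten ++ v) :
    c = d ∧ u = v := by
  induction k with
  | zero => exact ⟨Subsingleton.elim _ _, by simpa using h⟩
  | succ k ih =>
    simp only [List.ofFn_succ, List.flatten_cons, List.append_assoc] at h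
    obtain ⟨h0, h1⟩ := hc 0 _ _ _ h
    obtain ⟨h2, h3⟩ := ih (fun i => c i.succ) (fun i => d i.succ) (fun i => hc i.succ) h1
    refine ⟨?_, h3⟩
    ext i
    refine Fin.cases h0 (fun i => congrFun h2 i) i

namespace LTree

variable {X : Type*} {ar : X → ℕ}

/-- Polish notation is a prefix code. -/
theorem word_append_inj (t t' : LTree ar) (u v : List X) (h : t.word ++ u = t'.word ++ v) :
    t = t' ∧ u = v := by
  induction t generalizing t' u v with
  | node a c ih =>
    obtain ⟨b, d⟩ := t'
    simp only [word, List.cons_append, List.cons.injEq] at h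
    obtain ⟨rfl, h⟩ := h
    obtain ⟨rfl, rfl⟩ := List.flatten_ofFn_append_inj word c d (fun i => ih i) u v h
    exact ⟨rfl, rfl⟩

theorem word_injective : Function.Injective (word : LTree ar → List X) := fun t t' h =>
  (word_append_inj t t' [] [] (by simp [h])).1

theorem length_word_node (a : X) (c : Fin (ar a) → LTree ar) :
    (node a c).word.length = 1 + ∑ i, (c i).word.length := by
  simp [word, List.length_flatten, List.map_ofFn, List.sum_ofFn, add_comm]

theorem length_word_pos (t : LTree ar) : 0 < t.word.length := by
  obtain ⟨a, c⟩ := t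
  simp [word]

theorem wordWeight_word_node {s : ℕ} (w : X → Fin s →₀ ℕ) (a : X) (c : Fin (ar a) → LTree ar) :
    wordWeight w (node a c).word = w a + ∑ i, wordWeight w (c i).word := by
  simp [wordWeight, word, List.sum_flatten, List.map_flatten, List.map_ofFn, List.sum_ofFn,
    Function.comp_def]

theorem finite_wordWeight_word_eq [Finite X] {s : ℕ} (w : X → Fin s →₀ ℕ) (hw : ∀ a, w a ≠ 0)
    (n : Fin s →₀ ℕ) : {t : LTree ar | wordWeight w t.word = n}.Finite :=
  (finite_wordWeight_eq w hw n).preimage word_injective.injOn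

theorem finite_length_word_eq [Finite X] (n : ℕ) : {t : LTree ar | t.word.length = n}.Finite :=
  (List.finite_length_eq X n).preimage word_injective.injOn

end LTree

/-! ### Generating functions of weighted types -/

/-- The generating function of a type `T` weighted by `f`: the coefficient of `z ^ n` is the number
of elements of weight `n` (and `0` if there are infinitely many of them). -/
noncomputable def genFun {T : Type*} {s : ℕ} (f : T → Fin s →₀ ℕ) : MvPowerSeries (Fin s) ℤ :=
  fun n => (Nat.card {t : T // f t = n} : ℤ)

section genFun

variable {s : ℕ}

theorem coeff_genFun {T : Type*} (f : T → Fin s →₀ ℕ) (n : Fin s →₀ ℕ) :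
    MvPowerSeries.coeff n (genFun f) = (Nat.card {t : T // f t = n} : ℤ) := rfl

theorem genFun_congr {T T' : Type*} (e : T ≃ T') (f : T → Fin s →₀ ℕ) (f' : T' → Fin s →₀ ℕ)
    (h : ∀ t, f' (e t) = f t) : genFun f = genFun f' := by
  ext n
  rw [coeff_genFun, coeff_genFun,
    Nat.card_congr (e.subtypeEquiv (q := fun t => f' t = n) fun t => by rw [h])]

theorem genFun_sigma {I : Type*} [Fintype I] {T : I → Type*} (f : ∀ i, T i → Fin s →₀ ℕ)
    (hf : ∀ i n, Finite {t : T i // f i t = n}) :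
    genFun (fun p : Σ i, T i => f p.1 p.2) = ∑ i, genFun (f i) := by
  ext n
  have e : {p : Σ i, T i // f p.1 p.2 = n} ≃ Σ i, {t : T i // f i t = n} :=
    { toFun := fun p => ⟨p.1.1, p.1.2, p.2⟩
      invFun := fun p => ⟨⟨p.1, p.2.1⟩, p.2.2⟩
      left_inv := fun _ => rfl
      right_inv := fun _ => rfl }
  have := hf
  simp only [map_sum, coeff_genFun]
  rw [Nat.card_congr e, Nat.card_sigma]
  push_cast
  rfl

theorem genFun_const_add {T : Type*} (f : T → Fin s →₀ ℕ) (m : Fin s →₀ ℕ) :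
    genFun (fun t => m + f t) = MvPowerSeries.monomial m 1 * genFun f := by
  classical
  ext n
  rw [MvPowerSeries.coeff_monomial_mul, coeff_genFun, coeff_genFun]
  split_ifs with h
  · rw [one_mul, Nat.card_congr (Equiv.subtypeEquivRight fun t => ?_)]
    exact ⟨fun h' => by rw [← h', add_tsub_cancel_left], fun h' => by rw [h', add_tsub_cancel_of_le h]⟩
  · have : IsEmpty {t : T // m + f t = n} := ⟨fun t => h (t.2 ▸ le_self_add)⟩
    simp

theorem genFun_pi {I : Type*} [Fintype I] {T : I → Type*} (f : ∀ i, T i → Fin s →₀ ℕ)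
    (hf : ∀ i n, Finite {t : T i // f i t = n}) :
    genFun (fun g : ∀ i, T i => ∑ i, f i (g i)) = ∏ i, genFun (f i) := by
  classical
  ext n
  have e : {g : ∀ i, T i // ∑ i, f i (g i) = n} ≃
      Σ l : Finset.finsuppAntidiag (Finset.univ : Finset I) n, ∀ i, {t : T i // f i t = l.1 i} :=
    { toFun := fun g => ⟨⟨Finsupp.equivFunOnFinite.symm fun i => f i (g.1 i), by
          simp [Finset.mem_finsuppAntidiag, g.2]⟩, fun i => ⟨g.1 i, by simp⟩⟩
      invFun := fun p => ⟨fun i => (p.2 i).1, by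
        have := (Finset.mem_finsuppAntidiag.mp p.1.2).1
        simp only [(p.2 _).2]
        exact this⟩
      left_inv := fun _ => rfl
      right_inv := by
        rintro ⟨⟨l, hl⟩, g⟩
        obtain ⟨g, hg, rfl⟩ : ∃ (g' : ∀ i, T i) (h : ∀ i, f i (g' i) = l i),
            g = fun i => ⟨g' i, h i⟩ := ⟨fun i => (g i).1, fun i => (g i).2, rfl⟩
        obtain rfl : l = Finsupp.equivFunOnFinite.symm fun i => f i (g i) := by
          ext1 i
          simp [hg]
        rfl }
  have := hf
  rw [MvPowerSeries.coeff_prod, coeff_genFun, Nat.card_congr e, Nat.card_sigma,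
    Finset.sum_coe_sort (Finset.finsuppAntidiag Finset.univ n)
      (fun l => Nat.card (∀ i, {t : T i // f i t = l i}))]
  simp only [Nat.card_pi, coeff_genFun, Nat.cast_sum, Nat.cast_prod]

end genFun

/-! ### Tree automata and their generating functions -/

namespace LTree

variable {X Q : Type*} {ar : X → ℕ}

/-- A state function on trees is compositional if the state of a tree depends only on the label
of its root and on the states of its branches. With finitely many states, this is the same as
being computed by a deterministic bottom-up tree automaton. -/
def IsCompositional (st : LTree ar → Q) : Prop :=
  ∀ (a : X) (c d : Fin (ar a) → LTree ar), (∀ i, st (c i) = st (d i)) →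
    st (node a c) = st (node a d)

/-- The transitions into the state `q`: pairs of a root label and of states of the branches which
occur in some tree of state `q`. -/
structure Transition (st : LTree ar → Q) (q : Q) where
  /-- The label of the root. -/
  label : X
  /-- The states of the branches. -/
  branch : Fin (ar label) → Q
  exists_tree : ∃ d, (∀ i, st (d i) = branch i) ∧ st (node label d) = q

instance [Finite X] [Finite Q] (st : LTree ar → Q) (q : Q) : Finite (Transition st q) :=
  Finite.of_injective
    (fun p => (⟨p.label, p.branch⟩ : Σ a : X, (Fin (ar a) → Q))) fun p p' h => by
      obtain ⟨a, r, _⟩ := p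
      obtain ⟨a', r', _⟩ := p'
      cases h
      rfl

noncomputable instance [Finite X] [Finite Q] (st : LTree ar → Q) (q : Q) :
    Fintype (Transition st q) := Fintype.ofFinite _

variable {s : ℕ}

/-- The generating function of the trees of state `q`. -/
noncomputable def stateGenFun (w : X → Fin s →₀ ℕ) (st : LTree ar → Q) (q : Q) :
    MvPowerSeries (Fin s) ℤ :=
  genFun fun t : {t : LTree ar // st t = q} => wordWeight w t.1.word

/-- A tree of state `q` is a transition into `q` together with branches of the required states. -/
def decompose {st : LTree ar → Q} (hst : IsCompositional st) (q : Q) :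
    {t : LTree ar // st t = q} ≃
      Σ p : Transition st q, ∀ i, {t : LTree ar // st t = p.branch i} where
  toFun
    | ⟨node a c, h⟩ => ⟨⟨a, fun i => st (c i), c, fun _ => rfl, h⟩, fun i => ⟨c i, rfl⟩⟩
  invFun p := ⟨node p.1.label fun i => (p.2 i).1, by
    obtain ⟨d, h, h'⟩ := p.1.exists_tree
    exact (hst _ _ _ fun i => by rw [(p.2 i).2, h]).trans h'⟩
  left_inv := by
    rintro ⟨⟨a, c⟩, h⟩
    rfl
  right_inv := by
    rintro ⟨⟨a, r, h⟩, g⟩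
    obtain ⟨g, hg, rfl⟩ : ∃ (g' : Fin (ar a) → LTree ar) (h : ∀ i, st (g' i) = r i),
        g = fun i => ⟨g' i, h i⟩ := ⟨fun i => (g i).1, fun i => (g i).2, rfl⟩
    obtain rfl := funext hg
    rfl

theorem stateGenFun_eq [Finite X] [Finite Q] {w : X → Fin s →₀ ℕ} (hw : ∀ a, w a ≠ 0)
    {st : LTree ar → Q} (hst : IsCompositional st) (q : Q) :
    stateGenFun w st q = ∑ p : Transition st q,
      MvPowerSeries.monomial (w p.label) 1 * ∏ i, stateGenFun w st (p.branch i) := by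
  have fin (r : Q) (n) : Finite {t : {t : LTree ar // st t = r} // wordWeight w t.1.word = n} :=
    ((finite_wordWeight_word_eq w hw n).preimage Subtype.val_injective.injOn).to_subtype
  rw [stateGenFun, genFun_congr (decompose hst q) _ (fun p => w p.1.label +
    ∑ i, wordWeight w (p.2 i).1.word), genFun_sigma (I := Transition st q)
      (T := fun p => ∀ i : Fin (ar p.label), {t : LTree ar // st t = p.branch i})
      (fun p g => w p.label + ∑ i, wordWeight w (g i).1.word)]
  · refine Finset.sum_congr rfl fun p _ => ?_
    rw [genFun_const_add, genFun_pi (T := fun i => {t : LTree ar // st t = p.branch i})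
      (fun i t => wordWeight w t.1.word) (fun i n => fin _ n)]
    rfl
  · rintro p n
    have h : {g : ∀ i : Fin (ar p.label), {t : LTree ar // st t = p.branch i} |
        w p.label + ∑ i, wordWeight w (g i).1.word = n}.Finite := by
      refine (finite_wordWeight_word_eq (ar := ar) w hw n).preimage
        (f := fun g => node p.label fun i => (g i).1) ?_ |>.subset fun g hg => ?_
      · intro g _ g' _ h
        simp only [node.injEq, heq_eq_eq, true_and] at h
        exact funext fun i => Subtype.ext (congrFun h i)
      · simpa [wordWeight_word_node] using hg
    exact h.to_subtype
  · rintro ⟨⟨a, c⟩, h⟩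
    rw [wordWeight_word_node]
    rfl

end LTree

/-! ### Algebraicity -/

section Kaehler
open scoped KaehlerDifferential

/-- In characteristic zero, a field generated by finitely many elements whose differentials vanish
is algebraic over the base field. -/
theorem isAlgebraic_adjoin_of_forall_D_eq_zero {K L : Type*} [Field K] [Field L] [Algebra K L]
    [CharZero K] {S : Set L} (hS : S.Finite)
    (h : ∀ x (hx : x ∈ S), KaehlerDifferential.D K (IntermediateField.adjoin K S)
      ⟨x, IntermediateField.subset_adjoin K S hx⟩ = 0) :
    Algebra.IsAlgebraic K (IntermediateField.adjoin K S) := by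
  have hD : ∀ y : IntermediateField.adjoin K S,
      KaehlerDifferential.D K (IntermediateField.adjoin K S) y = 0 := by
    rintro ⟨y, hy⟩
    induction hy using IntermediateField.adjoin_induction with
    | mem x hx => exact h x hx
    | algebraMap x => exact (KaehlerDifferential.D K (IntermediateField.adjoin K S)).map_algebraMap x
    | add x y hx hy hx' hy' =>
      have := (KaehlerDifferential.D K (IntermediateField.adjoin K S)).map_add ⟨x, hx⟩ ⟨y, hy⟩
      rwa [hx', hy', add_zero] at this
    | mul x y hx hy hx' hy' =>
      have := (KaehlerDifferential.D K (IntermediateField.adjoin K S)).leibniz ⟨x, hx⟩ ⟨y, hy⟩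
      rwa [hx', hy', smul_zero, smul_zero, add_zero] at this
    | inv x hx hx' =>
      have := (KaehlerDifferential.D K (IntermediateField.adjoin K S)).leibniz_inv ⟨x, hx⟩
      rwa [hx', smul_zero] at this
  have : Subsingleton Ω[IntermediateField.adjoin K S⁄K] := by
    rw [← Submodule.subsingleton_iff (IntermediateField.adjoin K S), ← subsingleton_iff_bot_eq_top,
      ← KaehlerDifferential.span_range_derivation, eq_comm, Submodule.span_eq_bot]
    rintro _ ⟨y, rfl⟩
    exact hD y
  have : Algebra.FormallyUnramified K (IntermediateField.adjoin K S) := ⟨this⟩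
  have : Algebra.EssFiniteType K (IntermediateField.adjoin K S) :=
    IntermediateField.essFiniteType_iff.mpr (IntermediateField.fg_adjoin_of_finite hS)
  have := Algebra.FormallyUnramified.isSeparable K (IntermediateField.adjoin K S)
  infer_instance

end Kaehler

theorem Derivation.leibniz_finset_prod {R A M I : Type*} [CommSemiring R] [CommSemiring A]
    [AddCommMonoid M] [Algebra R A] [Module A M] [Module R M] [DecidableEq I] (D : Derivation R A M)
    (s : Finset I) (f : I → A) :
    D (∏ i ∈ s, f i) = ∑ i ∈ s, (∏ j ∈ s.erase i, f j) • D (f i) := by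
  induction s using Finset.induction_on with
  | empty => simp
  | insert a s ha ih =>
    rw [Finset.prod_insert ha, D.leibniz, ih, Finset.sum_insert ha, Finset.erase_insert ha,
      add_comm, Finset.smul_sum]
    congr 1
    refine Finset.sum_congr rfl fun i hi => ?_
    rw [Finset.erase_insert_of_ne (ne_of_mem_of_not_mem hi ha).symm, Finset.prod_insert, smul_smul]
    exact fun h => ha (Finset.mem_of_mem_erase h)

namespace MvPowerSeries

theorem constantCoeff_det_one_sub {s : ℕ} {I : Type*} [Fintype I] [DecidableEq I]
    (M : Matrix I I (MvPowerSeries (Fin s) ℤ)) (hM : ∀ i j, constantCoeff (M i j) = 0) :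
    constantCoeff (1 - M).det = 1 := by
  have : constantCoeff.mapMatrix (1 - M) = 1 := by
    rw [map_sub, map_one, sub_eq_self]
    ext i j
    exact hM i j
  rw [RingHom.map_det, this, Matrix.det_one]

/-- The coordinates of a solution in power series of a polynomial system `h = P(z, h)`, all
of whose monomials have a factor from the maximal ideal `(z)`, are algebraic: the Jacobian of
`h - P(z, h)` reduces to the identity modulo `(z)`, so that the differentials of the coordinates
vanish. -/
theorem isAlgebraic_of_polynomial_system {s : ℕ} {Q : Type*} [Finite Q]
    (h : Q → MvPowerSeries (Fin s) ℤ) (P : Q → Type*) [∀ q, Fintype (P q)]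
    (m : ∀ q, P q → MvPolynomial (Fin s) ℤ) (hm : ∀ q p, MvPolynomial.constantCoeff (m q p) = 0)
    (k : ∀ q, P q → ℕ) (r : ∀ q (p : P q), Fin (k q p) → Q)
    (hh : ∀ q, h q = ∑ p, (m q p : MvPowerSeries (Fin s) ℤ) * ∏ i, h (r q p i)) (q : Q) :
    IsAlgebraic (MvPolynomial (Fin s) ℤ) (h q) := by
  classical
  have := Fintype.ofFinite Q
  let A := MvPowerSeries (Fin s) ℤ
  let R := MvPolynomial (Fin s) ℤ
  let K := FractionRing R
  let L := FractionRing A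
  have hRA : Function.Injective (algebraMap R A) := MvPolynomial.coe_injective _ _
  have : FaithfulSMul R A := (faithfulSMul_iff_algebraMap_injective R A).mpr hRA
  have : FaithfulSMul R L := inferInstance
  let : Algebra K L := FractionRing.liftAlgebra R L
  have : IsScalarTower R K L := FractionRing.isScalarTower_liftAlgebra R L
  have : CharZero K := charZero_of_injective_algebraMap (IsFractionRing.injective R K)
  let S : Set L := Set.range fun q => algebraMap A L (h q)
  let F := IntermediateField.adjoin K S
  let g (q : Q) : F := ⟨algebraMap A L (h q), IntermediateField.subset_adjoin K S ⟨q, rfl⟩⟩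
  have hg (q : Q) : g q = ∑ p, algebraMap K F (algebraMap R K (m q p)) * ∏ i, g (r q p i) := by
    apply Subtype.ext
    change algebraMap A L (h q) = algebraMap F L _
    rw [hh q]
    simp only [map_sum, map_mul, map_prod]
    refine Finset.sum_congr rfl fun p _ => ?_
    congr 1
    rw [← IsScalarTower.algebraMap_apply K F L, ← IsScalarTower.algebraMap_apply R K L,
      IsScalarTower.algebraMap_apply R A L]
    rfl
  -- The matrix of partial derivatives of the right hand sides.
  let J : Matrix Q Q A := Matrix.of fun q q' => ∑ p, (m q p : A) *
    ∑ i, if r q p i = q' then ∏ j ∈ Finset.univ.erase i, h (r q p j) else 0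
  have hJ (q q') : constantCoeff (J q q') = 0 := by
    simp only [J, Matrix.of_apply, map_sum, map_mul]
    refine Finset.sum_eq_zero fun p _ => ?_
    have : constantCoeff (m q p : A) = 0 := hm q p
    rw [this, zero_mul]
  have hdet : ((algebraMap A L).mapMatrix (1 - J)).det ≠ 0 := by
    rw [← RingHom.map_det]
    intro h0
    have h1 := IsFractionRing.injective A L (h0.trans (map_zero _).symm)
    have h2 := constantCoeff_det_one_sub J hJ
    rw [h1, map_zero] at h2
    exact zero_ne_one h2
  have hD (q : Q) : KaehlerDifferential.D K F (g q) = 0 := by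
    rw [← Module.forall_dual_apply_eq_zero_iff F]
    intro φ
    let v (q : Q) : L := algebraMap F L (φ (KaehlerDifferential.D K F (g q)))
    -- The linear relations obtained by differentiating the system.
    have hv : (algebraMap A L).mapMatrix (1 - J) *ᵥ v = 0 := by
      rw [map_sub, map_one, Matrix.sub_mulVec, Matrix.one_mulVec, sub_eq_zero]
      ext q
      have h1 := congrArg (fun y => algebraMap F L (φ (KaehlerDifferential.D K F y))) (hg q)
      simp only [map_sum, Derivation.leibniz, Derivation.leibniz_finset_prod,
        Derivation.map_algebraMap, smul_zero, add_zero, map_smul, smul_eq_mul, map_mul,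
        map_prod] at h1
      refine h1.trans ?_
      simp only [Matrix.mulVec, dotProduct, RingHom.mapMatrix_apply, Matrix.map_apply, J,
        Matrix.of_apply, map_sum, map_mul, Finset.sum_mul]
      rw [Finset.sum_comm]
      refine Finset.sum_congr rfl fun p _ => ?_
      simp only [mul_assoc, ← Finset.mul_sum]
      have h2 : algebraMap F L (algebraMap K F (algebraMap R K (m q p))) =
          algebraMap A L (m q p : A) := by
        rw [← IsScalarTower.algebraMap_apply K F L, ← IsScalarTower.algebraMap_apply R K L,
          IsScalarTower.algebraMap_apply R A L]
        rfl
      rw [h2]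
      refine congrArg _ ?_
      rw [Finset.sum_congr rfl fun _ _ => Finset.sum_mul _ _ _, Finset.sum_comm]
      refine Finset.sum_congr rfl fun i _ => ?_
      rw [Finset.sum_eq_single (r q p i)]
      · rw [if_pos rfl, map_prod]
        rfl
      · intro b _ hb
        rw [if_neg hb.symm, map_zero, zero_mul]
      · simp
    have h3 := congrFun (Matrix.eq_zero_of_mulVec_eq_zero hdet hv) q
    exact (map_eq_zero_iff _ (algebraMap F L).injective).mp h3
  have hF : Algebra.IsAlgebraic K F :=
    isAlgebraic_adjoin_of_forall_D_eq_zero (Set.finite_range _) (by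
      rintro _ ⟨q, rfl⟩
      exact hD q)
  have h4 : IsAlgebraic K (algebraMap A L (h q)) :=
    (hF.isAlgebraic (g q)).algebraMap
  rw [← IsFractionRing.isAlgebraic_iff R K L] at h4
  exact (isAlgebraic_algebraMap_iff (IsFractionRing.injective A L)).mp h4

end MvPowerSeries

/-! ### Exponential growth from branching -/

namespace LTree

variable {X Q : Type*} {ar : X → ℕ}

/-- An injective binary operation on a nonempty set of trees which adds up the lengths of the
words, up to a constant, forces exponential growth: with `N j + k = 2 ^ j * (N 0 + k)` and two
trees of length `N 0`, there are at least `2 ^ 2 ^ j` trees of length `N j`. -/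
theorem not_subexponentialGrowth_of_injective2 [Finite X] (𝒯 : Set (LTree ar)) (L : Language X)
    (hL : ∀ t ∈ 𝒯, t.word ∈ L) (T : LTree ar → LTree ar → LTree ar) (hT : Function.Injective2 T)
    (hmem : ∀ u ∈ 𝒯, ∀ v ∈ 𝒯, T u v ∈ 𝒯) (k : ℕ)
    (hlen : ∀ u v, (T u v).word.length = k + (u.word.length + v.word.length))
    (hne : 𝒯.Nonempty) : ¬ SubexponentialGrowth L := by
  intro hsub
  obtain ⟨t, ht⟩ := hne
  let S (n : ℕ) : Set (LTree ar) := {u | u ∈ 𝒯 ∧ u.word.length = n}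
  have hS (n : ℕ) : (S n).Finite := (finite_length_word_eq n).subset fun u hu => hu.2
  have hgrowth (n : ℕ) : (S n).ncard ≤ growthFun L n := by
    rw [← Set.ncard_image_of_injective (S n) word_injective]
    refine Set.ncard_le_ncard ?_ ((List.finite_length_eq X n).subset fun u hu => hu.2)
    rintro _ ⟨u, hu, rfl⟩
    exact ⟨hL u hu.1, hu.2⟩
  -- The two bracketings of a triple product of `t` are distinct trees of the same length.
  obtain ⟨N, hN, hN2⟩ : ∃ N, 0 < N ∧ 2 ≤ (S N).ncard := by
    refine ⟨(T (T t t) t).word.length, length_word_pos _, ?_⟩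
    have hne : T (T t t) t ≠ T t (T t t) := by
      intro h
      have h1 := congrArg (fun u => u.word.length) (hT h).1
      simp only [hlen] at h1
      have := length_word_pos t
      omega
    rw [← Set.ncard_pair hne]
    refine Set.ncard_le_ncard ?_ (hS _)
    have hTt := hmem t ht t ht
    rintro u (rfl | rfl)
    · exact ⟨hmem _ hTt _ ht, rfl⟩
    · refine ⟨hmem _ ht _ hTt, ?_⟩
      simp only [hlen]
      omega
  have hdouble (n : ℕ) : (S n).ncard ^ 2 ≤ (S (k + (n + n))).ncard := by
    rw [sq, ← Set.ncard_prod, ← Set.ncard_image_of_injective _ hT.uncurry]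
    refine Set.ncard_le_ncard ?_ (hS _)
    rintro _ ⟨⟨u, v⟩, ⟨hu, hv⟩, rfl⟩
    exact ⟨hmem u hu.1 v hv.1, by simp only [Function.uncurry, hlen, hu.2, hv.2]⟩
  have hpow (j : ℕ) : ∃ n, n + k = 2 ^ j * (N + k) ∧ 2 ^ 2 ^ j ≤ (S n).ncard := by
    induction j with
    | zero => exact ⟨N, by simp, by simpa using hN2⟩
    | succ j ih =>
      obtain ⟨n, h1, h2⟩ := ih
      refine ⟨k + (n + n), by rw [pow_succ]; linarith, le_trans ?_ (hdouble n)⟩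
      rw [pow_succ 2 j, pow_mul]
      exact Nat.pow_le_pow_left h2 2
  -- With this base, `c ^ (n + k) = 2 ^ 2 ^ j` whenever `n + k = 2 ^ j * (N + k)`.
  let c : ℝ := 2 ^ (((N + k : ℕ) : ℝ)⁻¹)
  have hM : 0 < N + k := by omega
  have hc : 1 < c := Real.one_lt_rpow one_lt_two (by positivity)
  have hcM : c ^ (N + k) = 2 := Real.rpow_inv_natCast_pow zero_le_two hM.ne'
  obtain ⟨n₀, hn₀⟩ := eventually_atTop.mp ((hsub c hc).def (one_half_pos (α := ℝ)))
  obtain ⟨n, h1, h2⟩ := hpow (n₀ + k)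
  have hn : n₀ ≤ n := by
    have h3 : n₀ + k < 2 ^ (n₀ + k) := Nat.lt_two_pow_self
    have h4 : 2 ^ (n₀ + k) ≤ 2 ^ (n₀ + k) * (N + k) := Nat.le_mul_of_pos_right _ hM
    omega
  have h3 := hn₀ n hn
  rw [Real.norm_of_nonneg (by positivity), Real.norm_of_nonneg (by positivity)] at h3
  have h4 : c ^ n ≤ 2 ^ 2 ^ (n₀ + k) := by
    rw [← hcM, ← pow_mul, mul_comm, ← h1]
    exact pow_le_pow_right₀ hc.le (Nat.le_add_right _ _)
  have h5 : (2 : ℝ) ^ 2 ^ (n₀ + k) ≤ growthFun L n := by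
    exact_mod_cast h2.trans (hgrowth n)
  have h6 : (0 : ℝ) < 2 ^ 2 ^ (n₀ + k) := by positivity
  linarith

/-- The state `r` occurs at a child of the root of some tree of state `q`. -/
def IsBranchState (st : LTree ar → Q) (r q : Q) : Prop :=
  ∃ (a : X) (c : Fin (ar a) → LTree ar) (i : Fin (ar a)), st (c i) = r ∧ st (node a c) = q

/-- The state `r` occurs at some vertex of some tree of state `q`. -/
def OccursIn (st : LTree ar → Q) : Q → Q → Prop :=
  Relation.ReflTransGen (IsBranchState st)

theorem length_word_node_update (a : X) (c : Fin (ar a) → LTree ar) (i : Fin (ar a))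
    (t : LTree ar) : (node a (Function.update c i t)).word.length =
      (1 + ∑ j ∈ Finset.univ.erase i, (c j).word.length) + t.word.length := by
  rw [length_word_node, ← Finset.add_sum_erase _ _ (Finset.mem_univ i), Function.update_self,
    Finset.sum_congr rfl fun j hj => by rw [Function.update_of_ne (Finset.ne_of_mem_erase hj)]]
  ring

/-- If `r` occurs in trees of state `q`, there is a tree of state `q` with a hole for trees of
state `r`. -/
theorem OccursIn.exists_context {st : LTree ar → Q} (hst : IsCompositional st) {r q : Q}
    (h : OccursIn st r q) : ∃ (C : LTree ar → LTree ar) (k : ℕ), Function.Injective C ∧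
      (∀ t, st t = r → st (C t) = q) ∧ ∀ t, (C t).word.length = k + t.word.length := by
  induction h with
  | refl => exact ⟨id, 0, Function.injective_id, fun _ => id, by simp⟩
  | tail _ h ih =>
    obtain ⟨C, k, h1, h2, h3⟩ := ih
    obtain ⟨a, c, i, hi, hq⟩ := h
    refine ⟨fun t => node a (Function.update c i (C t)),
      (1 + ∑ j ∈ Finset.univ.erase i, (c j).word.length) + k, ?_, ?_, ?_⟩
    · intro t t' htt
      simp only [node.injEq, heq_eq_eq, true_and] at htt
      exact h1 (Function.update_injective c i htt)
    · intro t ht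
      rw [← hq]
      refine hst _ _ _ fun j => ?_
      rcases eq_or_ne j i with rfl | hj
      · rw [Function.update_self, h2 t ht, hi]
      · rw [Function.update_of_ne hj]
    · intro t
      rw [length_word_node_update, h3, ← add_assoc]

/-- If a tree of state `q` has two branches in whose states `q` occurs again, then every
language containing the words of all trees of state `q` grows exponentially. -/
theorem not_subexponentialGrowth_of_branching [Finite X] {st : LTree ar → Q}
    (hst : IsCompositional st) {q : Q} {L : Language X} (hL : ∀ t, st t = q → t.word ∈ L)
    (a : X) (d : Fin (ar a) → LTree ar) (hd : st (node a d) = q) (i j : Fin (ar a)) (hij : i ≠ j)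
    (hi : OccursIn st q (st (d i))) (hj : OccursIn st q (st (d j))) :
    ¬ SubexponentialGrowth L := by
  obtain ⟨C, k, hC1, hC2, hC3⟩ := hi.exists_context hst
  obtain ⟨D, l, hD1, hD2, hD3⟩ := hj.exists_context hst
  let T (u v : LTree ar) : LTree ar :=
    node a (Function.update (Function.update d i (C u)) j (D v))
  refine not_subexponentialGrowth_of_injective2 {t | st t = q} L hL T ?_ ?_
    (1 + (∑ m ∈ (Finset.univ.erase j).erase i, (d m).word.length) + k + l) ?_ ⟨_, hd⟩
  · intro u u' v v' h
    simp only [T, node.injEq, heq_eq_eq, true_and] at h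
    have h1 := congrFun h i
    have h2 := congrFun h j
    simp only [Function.update_of_ne hij, Function.update_self] at h1 h2
    exact ⟨hC1 h1, hD1 h2⟩
  · intro u hu v hv
    refine (hst _ _ _ fun m => ?_).trans hd
    rcases eq_or_ne m j with rfl | hmj
    · rw [Function.update_self, hD2 v hv]
    · rw [Function.update_of_ne hmj]
      rcases eq_or_ne m i with rfl | hmi
      · rw [Function.update_self, hC2 u hu]
      · rw [Function.update_of_ne hmi]
  · intro u v
    rw [length_word_node_update, hD3,
      ← Finset.add_sum_erase _ _ (Finset.mem_erase.mpr ⟨hij, Finset.mem_univ i⟩),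
      Function.update_self, hC3, Finset.sum_congr rfl fun m hm => by
        rw [Function.update_of_ne (Finset.ne_of_mem_erase hm)]]
    ring

end LTree

/-! ### Rationality -/

/-- The subring of rational power series. -/
def rationalSeries (s : ℕ) : Subring (MvPowerSeries (Fin s) ℤ) where
  carrier := {F | IsRationalSeries F}
  zero_mem' := ⟨0, 1, by simp, by simp⟩
  one_mem' := ⟨1, 1, by simp, by simp⟩
  add_mem' := by
    rintro F G ⟨p, q, hq, h⟩ ⟨p', q', hq', h'⟩
    refine ⟨p * q' + p' * q, q * q', by simp [hq, hq'], ?_⟩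
    push_cast
    rw [← h, ← h']
    ring
  mul_mem' := by
    rintro F G ⟨p, q, hq, h⟩ ⟨p', q', hq', h'⟩
    refine ⟨p * p', q * q', by simp [hq, hq'], ?_⟩
    push_cast
    rw [← h, ← h']
    ring
  neg_mem' := by
    rintro F ⟨p, q, hq, h⟩
    refine ⟨-p, q, hq, ?_⟩
    have : ((-p : MvPolynomial (Fin s) ℤ) : MvPowerSeries (Fin s) ℤ) = -p :=
      map_neg (MvPolynomial.coeToMvPowerSeries.ringHom (R := ℤ) (σ := Fin s)) p
    rw [this, ← h, mul_neg]

theorem MvPowerSeries.monomial_mem_rationalSeries {s : ℕ} (m : Fin s →₀ ℕ) :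
    MvPowerSeries.monomial m 1 ∈ rationalSeries s :=
  ⟨MvPolynomial.monomial m 1, 1, by simp, by simp⟩

theorem MvPowerSeries.mem_rationalSeries_of_mul_mem {s : ℕ} {D F : MvPowerSeries (Fin s) ℤ}
    (hD : D ∈ rationalSeries s) (hD0 : constantCoeff D ≠ 0) (h : D * F ∈ rationalSeries s) :
    F ∈ rationalSeries s := by
  obtain ⟨p, q, hq, h1⟩ := hD
  obtain ⟨p', q', hq', h2⟩ := h
  have hp : MvPolynomial.constantCoeff p ≠ 0 := by
    have h3 : constantCoeff (q * D : MvPowerSeries (Fin s) ℤ) = MvPolynomial.constantCoeff p := by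
      rw [h1]
      rfl
    have h4 : constantCoeff (q : MvPowerSeries (Fin s) ℤ) ≠ 0 := hq
    rw [← h3, map_mul]
    exact mul_ne_zero h4 hD0
  refine ⟨q * p', q' * p, by simp [hq', hp], ?_⟩
  push_cast
  rw [← h1, ← h2]
  ring

/-- The solution of a linear system `h = b + M h` with rational coefficients is rational if `M`
vanishes at `z = 0`: then `det (1 - M)` has constant coefficient `1`. -/
theorem MvPowerSeries.mem_rationalSeries_of_linear_system {s : ℕ} {I : Type*} [Fintype I]
    (h b : I → MvPowerSeries (Fin s) ℤ) (M : Matrix I I (MvPowerSeries (Fin s) ℤ))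
    (hb : ∀ i, b i ∈ rationalSeries s) (hM : ∀ i j, M i j ∈ rationalSeries s)
    (hM0 : ∀ i j, constantCoeff (M i j) = 0) (hh : h = b + M *ᵥ h) (i : I) :
    h i ∈ rationalSeries s := by
  classical
  let ι := (rationalSeries s).subtype
  obtain ⟨N, hN⟩ : ∃ N : Matrix I I (rationalSeries s), ι.mapMatrix N = 1 - M := by
    refine ⟨1 - Matrix.of fun i j => ⟨M i j, hM i j⟩, ?_⟩
    rw [map_sub, map_one]
    rfl
  have h1 : (1 - M) *ᵥ h = b := by
    rw [Matrix.sub_mulVec, Matrix.one_mulVec, sub_eq_iff_eq_add]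
    exact hh
  have h2 : (1 - M).det • h = (1 - M).adjugate *ᵥ b := by
    rw [← h1, Matrix.mulVec_mulVec, Matrix.adjugate_mul, Matrix.smul_mulVec, Matrix.one_mulVec]
  refine mem_rationalSeries_of_mul_mem (D := (1 - M).det) ?_ ?_ ?_
  · rw [← hN, ← RingHom.map_det]
    exact N.det.2
  · rw [constantCoeff_det_one_sub M hM0]
    exact one_ne_zero
  · have h3 := congrFun h2 i
    rw [Pi.smul_apply, smul_eq_mul] at h3
    rw [h3, ← hN, ← RingHom.map_adjugate]
    exact Subring.sum_mem _ fun j _ => Subring.mul_mem _ (N.adjugate i j).2 (hb j)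

namespace LTree

variable {X Q : Type*} {ar : X → ℕ} {s : ℕ}

/-- If no tree whose state occurs in `q` has two branches that lead back to its own state, then the
generating function of `q` is rational: the equations of the states in the strongly connected
component of `q` are linear in these states, with coefficients which are polynomials in
generating functions of lower components. -/
theorem isRationalSeries_stateGenFun [Finite X] [Finite Q] {w : X → Fin s →₀ ℕ}
    (hw : ∀ a, w a ≠ 0) {st : LTree ar → Q} (hst : IsCompositional st) (q : Q)
    (hq : ∀ a (d : Fin (ar a) → LTree ar), OccursIn st (st (node a d)) q → ∀ i j, i ≠ j →
      OccursIn st (st (node a d)) (st (d i)) → ¬ OccursIn st (st (node a d)) (st (d j))) :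
    IsRationalSeries (stateGenFun w st q) := by
  classical
  induction hn : {r | OccursIn st r q}.ncard using Nat.strong_induction_on generalizing q with
  | _ n ih =>
  -- States which lie strictly below the component of `q`.
  have hlow (r : Q) (h1 : OccursIn st r q) (h2 : ¬ OccursIn st q r) :
      stateGenFun w st r ∈ rationalSeries s := by
    refine ih _ ?_ r (fun a d h => hq a d (h.trans h1)) rfl
    rw [← hn]
    refine Set.ncard_lt_ncard ⟨fun r' h => Relation.ReflTransGen.trans h h1, fun h => h2 ?_⟩
      (Set.toFinite _)
    exact h (a := q) Relation.ReflTransGen.refl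
  let I := {r : Q // OccursIn st r q ∧ OccursIn st q r}
  have : Fintype I := Fintype.ofFinite I
  have hterm (r : I) (p : Transition st r.1) : ∃ (b : MvPowerSeries (Fin s) ℤ)
      (m : I → MvPowerSeries (Fin s) ℤ), b ∈ rationalSeries s ∧ (∀ r', m r' ∈ rationalSeries s) ∧
      (∀ r', MvPowerSeries.constantCoeff (m r') = 0) ∧
      MvPowerSeries.monomial (w p.label) 1 * ∏ i, stateGenFun w st (p.branch i) =
        b + ∑ r', m r' * stateGenFun w st r'.1 := by
    obtain ⟨r, hr1, hr2⟩ := r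
    obtain ⟨a, e, d, hd, h⟩ := p
    obtain rfl : st (node a d) = r := h
    obtain rfl := funext hd
    have hstep (i) : OccursIn st (st (d i)) q :=
      Relation.ReflTransGen.head ⟨a, d, i, rfl, rfl⟩ hr1
    by_cases hex : ∃ i, OccursIn st q (st (d i))
    -- At most one branch has a state in the component of `q`; its generating function is the
    -- unknown, and those of all other branches go into the coefficient.
    · obtain ⟨i, hi⟩ := hex
      let m : MvPowerSeries (Fin s) ℤ := MvPowerSeries.monomial (w a) 1 *
        ∏ j ∈ Finset.univ.erase i, stateGenFun w st (st (d j))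
      have hm : m ∈ rationalSeries s := by
        refine Subring.mul_mem _ (MvPowerSeries.monomial_mem_rationalSeries _)
          (Subring.prod_mem _ fun j hj => hlow _ (hstep j) fun hj' => ?_)
        exact hq a d hr1 i j (Finset.ne_of_mem_erase hj).symm (hr1.trans hi) (hr1.trans hj')
      have hm0 : MvPowerSeries.constantCoeff m = 0 := by
        have : MvPowerSeries.constantCoeff
            (MvPowerSeries.monomial (w a) 1 : MvPowerSeries (Fin s) ℤ) = 0 := by
          rw [← MvPowerSeries.coeff_zero_eq_constantCoeff_apply, MvPowerSeries.coeff_monomial,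
            if_neg (hw a).symm]
        rw [map_mul, this, zero_mul]
      refine ⟨0, Pi.single ⟨st (d i), hstep i, hi⟩ m, Subring.zero_mem _, fun r' => ?_,
        fun r' => ?_, ?_⟩
      · rw [Pi.single_apply]
        split_ifs
        exacts [hm, Subring.zero_mem _]
      · rw [Pi.single_apply]
        split_ifs
        exacts [hm0, map_zero _]
      · rw [zero_add, Finset.sum_eq_single ⟨st (d i), hstep i, hi⟩, Pi.single_eq_same,
          ← Finset.mul_prod_erase _ _ (Finset.mem_univ i)]
        · simp only [m]
          ring
        · intro r' _ hr'
          rw [Pi.single_eq_of_ne hr', zero_mul]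
        · simp
    · push Not at hex
      refine ⟨_, 0, ?_, fun _ => Subring.zero_mem _, fun _ => map_zero _,
        by simp only [Pi.zero_apply, zero_mul, Finset.sum_const_zero, add_zero]; rfl⟩
      exact Subring.mul_mem _ (MvPowerSeries.monomial_mem_rationalSeries _)
        (Subring.prod_mem _ fun j _ => hlow _ (hstep j) (hex j))
  choose b m hb hm hm0 heq using hterm
  refine MvPowerSeries.mem_rationalSeries_of_linear_system (I := I)
    (fun r => stateGenFun w st r.1) (fun r => ∑ p, b r p) (fun r r' => ∑ p, m r p r')
    (fun r => Subring.sum_mem _ fun p _ => hb r p)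
    (fun r r' => Subring.sum_mem _ fun p _ => hm r p r') (fun r r' => ?_) ?_
    ⟨q, Relation.ReflTransGen.refl, Relation.ReflTransGen.refl⟩
  · rw [map_sum]
    exact Finset.sum_eq_zero fun p _ => hm0 r p r'
  · ext1 r
    rw [stateGenFun_eq hw hst, Finset.sum_congr rfl fun p _ => heq r p, Finset.sum_add_distrib,
      Finset.sum_comm]
    simp only [Pi.add_apply, Matrix.mulVec, dotProduct, Finset.sum_mul]

end LTree

/-! ### The automaton of a finite set of forbidden trees -/

namespace LTree

variable {X : Type*} {ar : X → ℕ}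

/-- The subtrees of a tree: each consists of a vertex and all its descendants. -/
def subtrees : LTree ar → Set (LTree ar)
  | node a c => insert (node a c) (⋃ i, (c i).subtrees)

theorem self_mem_subtrees (t : LTree ar) : t ∈ t.subtrees := by
  cases t
  rw [subtrees]
  exact Set.mem_insert _ _

theorem finite_subtrees (t : LTree ar) : t.subtrees.Finite := by
  induction t with
  | node a c ih =>
    rw [subtrees]
    exact (Set.finite_iUnion ih).insert _

theorem branch_mem_subtrees {a : X} {c : Fin (ar a) → LTree ar} {t : LTree ar}
    (h : node a c ∈ t.subtrees) (i : Fin (ar a)) : c i ∈ t.subtrees := by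
  induction t with
  | node b d ih =>
    rw [subtrees] at h ⊢
    rcases h with h | h
    · cases h
      exact Or.inr (Set.mem_iUnion.mpr ⟨i, self_mem_subtrees _⟩)
    · obtain ⟨j, hj⟩ := Set.mem_iUnion.mp h
      exact Or.inr (Set.mem_iUnion.mpr ⟨j, ih j hj⟩)

theorem isRootedSubtree_node_congr {x : X} {S : Set (LTree ar)}
    (hS : ∀ (a : X) (c : Fin (ar a) → LTree ar), node a c ∈ S → ∀ i, c i ∈ S) {a : X}
    {c d : Fin (ar a) → LTree ar}
    (h : ∀ i, ∀ p ∈ S, IsRootedSubtree x p (c i) → IsRootedSubtree x p (d i))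
    {p : LTree ar} (hp : p ∈ S) (hpc : IsRootedSubtree x p (node a c)) :
    IsRootedSubtree x p (node a d) := by
  cases hpc with
  | freeEnd e => exact .freeEnd e _
  | node _ e _ he => exact .node a e d fun i => h i _ (hS a e hp i) (he i)

theorem avoids_node_iff {x : X} {Y : Set (LTree ar)} {a : X} {c : Fin (ar a) → LTree ar} :
    Avoids x Y (node a c) ↔
      (∀ i, Avoids x Y (c i)) ∧ ∀ p ∈ Y, ¬ IsRootedSubtree x p (node a c) := by
  refine ⟨fun h => ⟨fun i p hp hc => h p hp (.child a c i hc), fun p hp hr => h p hp (.root _ hr)⟩,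
    fun h p hp hc => ?_⟩
  cases hc with
  | root _ hr => exact h.2 p hp hr
  | child _ _ i hi => exact h.1 i p hp hi

/-- The state of a tree with respect to the forbidden trees `Y`: which subtrees of elements of `Y`
occur in it at the root, and whether it avoids `Y`. -/
def patternState (x : X) (Y : Set (LTree ar)) (t : LTree ar) :
    Set (⋃ p ∈ Y, p.subtrees : Set (LTree ar)) × Prop :=
  ({p | IsRootedSubtree x p.1 t}, Avoids x Y t)

theorem finite_patternState {Y : Set (LTree ar)} (hY : Y.Finite) :
    Finite (Set (⋃ p ∈ Y, p.subtrees : Set (LTree ar)) × Prop) := by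
  have : Finite (⋃ p ∈ Y, p.subtrees : Set (LTree ar)) :=
    (hY.biUnion fun p _ => finite_subtrees p).to_subtype
  infer_instance

theorem isCompositional_patternState (x : X) (Y : Set (LTree ar)) :
    IsCompositional (patternState x Y) := by
  intro a c d h
  have hS : ∀ (a : X) (c : Fin (ar a) → LTree ar), node a c ∈ ⋃ p ∈ Y, p.subtrees →
      ∀ i, c i ∈ ⋃ p ∈ Y, p.subtrees := by
    intro a c h i
    simp only [Set.mem_iUnion] at h ⊢
    obtain ⟨p, hp, h⟩ := h
    exact ⟨p, hp, branch_mem_subtrees h i⟩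
  have hY {p} (hp : p ∈ Y) : p ∈ ⋃ p ∈ Y, p.subtrees :=
    Set.mem_biUnion hp (self_mem_subtrees p)
  have h1 (i) (p) (hp : p ∈ ⋃ p ∈ Y, p.subtrees) :
      IsRootedSubtree x p (c i) ↔ IsRootedSubtree x p (d i) :=
    Set.ext_iff.mp (congrArg Prod.fst (h i)) ⟨p, hp⟩
  have h2 (i) : Avoids x Y (c i) ↔ Avoids x Y (d i) := iff_of_eq (congrArg Prod.snd (h i))
  have h3 {p} (hp : p ∈ ⋃ p ∈ Y, p.subtrees) :
      IsRootedSubtree x p (node a c) ↔ IsRootedSubtree x p (node a d) :=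
    ⟨isRootedSubtree_node_congr hS (fun i p hp => (h1 i p hp).1) hp,
      isRootedSubtree_node_congr hS (fun i p hp => (h1 i p hp).2) hp⟩
  refine Prod.ext (Set.ext fun p => h3 p.2) (propext ?_)
  change Avoids x Y (node a c) ↔ Avoids x Y (node a d)
  rw [avoids_node_iff, avoids_node_iff]
  exact and_congr (forall_congr' h2) (forall₂_congr fun p hp => not_congr (h3 (hY hp)))

/-- A state which occurs in an avoiding state is avoiding. -/
theorem OccursIn.avoids {x : X} {Y : Set (LTree ar)}
    {r q : Set (⋃ p ∈ Y, p.subtrees : Set (LTree ar)) × Prop}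
    (h : OccursIn (patternState x Y) r q) (hq : q.2) : r.2 := by
  induction h with
  | refl => exact hq
  | tail _ h ih =>
    obtain ⟨a, c, i, rfl, rfl⟩ := h
    exact ih ((avoids_node_iff.mp hq).1 i)

open Classical in
theorem weightedGenFun_avoidingLanguage [Finite X] (x : X) (Y : Set (LTree ar)) {s : ℕ}
    {w : X → Fin s →₀ ℕ} (hw : ∀ a, w a ≠ 0)
    [Fintype (Set (⋃ p ∈ Y, p.subtrees : Set (LTree ar)) × Prop)] :
    weightedGenFun w (avoidingLanguage x Y) =
      ∑ q : Set (⋃ p ∈ Y, p.subtrees : Set (LTree ar)) × Prop with q.2,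
        stateGenFun w (patternState x Y) q := by
  let f (t : {t : LTree ar // Avoids x Y t}) : Fin s →₀ ℕ := wordWeight w t.1.word
  have h1 : weightedGenFun w (avoidingLanguage x Y) = genFun f := by
    ext n
    rw [coeff_genFun]
    change ((Set.ncard _ : ℕ) : ℤ) = _
    rw [Nat.cast_inj]
    refine (Nat.card_congr (Equiv.ofBijective (fun t => ⟨t.1.1.word, ⟨t.1.1, t.1.2, rfl⟩, t.2⟩)
      ⟨fun t t' h => ?_, ?_⟩)).symm
    · exact Subtype.ext (Subtype.ext (word_injective (congrArg Subtype.val h)))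
    · rintro ⟨_, ⟨t, ht, rfl⟩, hn⟩
      exact ⟨⟨⟨t, ht⟩, hn⟩, rfl⟩
  let e : {t : LTree ar // Avoids x Y t} ≃
      Σ q : {q : Set (⋃ p ∈ Y, p.subtrees : Set (LTree ar)) × Prop // q.2},
        {t : LTree ar // patternState x Y t = q.1} :=
    { toFun := fun t => ⟨⟨patternState x Y t.1, t.2⟩, t.1, rfl⟩
      invFun := fun p => ⟨p.2.1, by
        have := p.1.2
        rw [← p.2.2] at this
        exact this⟩
      left_inv := fun _ => rfl
      right_inv := by
        rintro ⟨⟨q, hq⟩, t, h⟩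
        obtain rfl : patternState x Y t = q := h
        rfl }
  rw [h1, genFun_congr e f (fun p => wordWeight w p.2.1.word) fun _ => rfl,
    genFun_sigma (T := fun q : {q : Set (⋃ p ∈ Y, p.subtrees : Set (LTree ar)) × Prop // q.2} =>
      {t : LTree ar // patternState x Y t = q.1}) (fun _ t => wordWeight w t.1.word)
      fun q n => ((finite_wordWeight_word_eq w hw n).preimage
        Subtype.val_injective.injOn).to_subtype]
  symm
  exact Finset.sum_subtype _ (fun q => Finset.mem_filter_univ q) _

end LTree

theorem mainTheorem3 {X : Type*} [Finite X] (ar : X → ℕ) (x : X)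
    (hx : ∀ a : X, ar a = 0 ↔ a = x)
    (Y : Set (LTree ar)) (hY : Y.Finite)
    {s : ℕ} (w : X → Fin s →₀ ℕ) (hw : ∀ a : X, w a ≠ 0) :
    (∃ P : Polynomial (MvPolynomial (Fin s) ℤ), P ≠ 0 ∧
      Polynomial.eval₂ (MvPolynomial.coeToMvPowerSeries.ringHom (R := ℤ) (σ := Fin s))
        (weightedGenFun w (LTree.avoidingLanguage x Y)) P = 0) ∧
    (SubexponentialGrowth (LTree.avoidingLanguage x Y) →
      IsRationalSeries (weightedGenFun w (LTree.avoidingLanguage x Y))) := by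
  classical
  have := LTree.finite_patternState hY
  have := Fintype.ofFinite (Set (⋃ p ∈ Y, p.subtrees : Set (LTree ar)) × Prop)
  have hst := LTree.isCompositional_patternState x Y
  rw [LTree.weightedGenFun_avoidingLanguage x Y hw]
  constructor
  · have halg (q) : IsAlgebraic (MvPolynomial (Fin s) ℤ)
        (LTree.stateGenFun w (LTree.patternState x Y) q) := by
      refine MvPowerSeries.isAlgebraic_of_polynomial_system _
        (LTree.Transition (LTree.patternState x Y))
        (fun _ p => MvPolynomial.monomial (w p.label) 1) (fun _ p => ?_) (fun _ p => ar p.label)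
        (fun _ p => p.branch) (fun q => ?_) q
      · rw [MvPolynomial.constantCoeff_monomial, if_neg (hw _)]
      · simp only [MvPolynomial.coe_monomial]
        exact LTree.stateGenFun_eq hw hst q
    exact Subalgebra.sum_mem (Subalgebra.algebraicClosure (MvPolynomial (Fin s) ℤ) _)
      fun q _ => halg q
  · intro hsub
    refine Subring.sum_mem (rationalSeries s) fun q hq => ?_
    refine LTree.isRationalSeries_stateGenFun hw hst q fun a d had i j hij hi hj => ?_
    have hav := had.avoids (Finset.mem_filter.mp hq).2
    refine LTree.not_subexponentialGrowth_of_branching hst (fun t ht => ?_) a d rfl i j hij hi hj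
      hsub
    rw [← ht] at hav
    exact ⟨t, hav, rfl⟩
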